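/- Let $V=\mathrm{Mat}_d(\mathbb C)$ with involution $*$ and identify $\mathrm{Mat}_s(V)=\mathrm{Mat}_d(\mathbb C)\otimes\mathrm{Mat}_s(\mathbb C)$. An (abstract) operator system on $V$ is a family $\mathcal C=(\mathcal C_s)_{s\ge1}$ of closed salient convex cones $\mathcal C_s\subseteq\mathrm{Mat}_s(V)_h$ of Hermitian elements, with some $u\in\mathcal C_1$, such that $W^*AW\in\mathcal C_t$ whenever $A\in\mathcal C_s$, $W\in\mathrm{Mat}_{s,t}(\mathbb C)$, and $u\otimes I_s$ is an order unit of $\mathcal C_s$ for every $s$. A finite-dimensional realization of $\mathcal C$ is a $*$-linear map $\varphi:V\to\mathbb B(\mathcal H)$, with $\mathcal H$ a finite-dimensional complex Hilbert space and $\varphi(u)=\mathrm{id}_{\mathcal H}$, such that for all $s$ and all Hermitian $A\in\mathrm{Mat}_s(V)_h$: $A\in\mathcal C_s\Leftrightarrow(\varphi\otimes\mathrm{id})(A)\ge0$. The family $\mathcal C$ is a free spectrahedron if for some $r$ there is a $*$-linear map $\varphi:V\to\mathrm{Mat}_r(\mathbb C)$ (i.e. a choice of Hermitian $r\times r$ coefficient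 matrices for a basis of $V_h$) with $\mathcal C_s=\{A\in\mathrm{Mat}_s(V)_h:(\varphi\otimes\mathrm{id})(A)\ge0\}$ for all $s$. The system $\mathcal C$ is finitely generated if there are finitely many elements of $\mathcal C$ such that $\mathcal C$ is the smallest operator system containing them. Let $X^\Gamma$ be the partial transpose $\sum_i A_i\otimes B_i\mapsto\sum_i A_i^T\otimes B_i$, and put $$\mathrm{Dpsd}_{d,s}=\{X: X\ge0,\ X^\Gamma\ge0\},\qquad \mathrm{Decomp}_{d,s}=\{X+Y: X\ge0,\ Y^\Gamma\ge0\}$$ for $X,Y\in\mathrm{Mat}_d(\mathbb C)\otimes\mathrm{Mat}_s(\mathbb C)$. A linear map $T:\mathrm{Mat}_d(\mathbb C)\to\mathrm{Mat}_s(\mathbb C)$ is doubly completely positive if $T$ and $X\mapsto T(X^T)$ are both completely positive. **Theorem.** Let $d\ge2$. Then: 1. $\mathrm{Decomp}_d=(\mathrm{Decomp}_{d,s})_s$ is an operator system (with $u=I_d$) that has no finite-dimensional realization; moreover, it is not a free spectrahedron. 2. $\mathrm{Dpsd}_d=(\mathrm{Dpsd}_{d,s})_s$ is an operator system (with $u=I_d$)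 that is not finitely generated. 3. Doubly completely positive maps admit no finitary Choi-type characterization: there is no finite list of doubly completely positive maps $S_j:\mathrm{Mat}_d(\mathbb C)\to\mathrm{Mat}_{s_j}(\mathbb C)$, $j=1,\dots,n$, such that, for every $t$, every doubly completely positive map $T:\mathrm{Mat}_d(\mathbb C)\to\mathrm{Mat}_t(\mathbb C)$ has the form $T(X)=\sum_{i=1}^m W_i^*\,S_{j_i}(X)\,W_i$ for some $m$, some indices $j_1,\dots,j_m$ and complex matrices $W_i$ of suitable size. -/

import Mathlib

open scoped Matrix ComplexOrder

universe w

namespace OpSys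

section General

variable {V : Type*} [AddCommGroup V] [Module ℂ V]

/-- The compression `W* A W` of an `s × s` matrix `A` with entries in a complex vector space `V` by
a complex `s × t` matrix `W`. -/
def compress {s t : ℕ} (A : Matrix (Fin s) (Fin s) V) (W : Matrix (Fin s) (Fin t) ℂ) :
    Matrix (Fin t) (Fin t) V :=
  Matrix.of fun k l => ∑ i, ∑ j, (star (W i k) * W j l) • A i j

/-- `C`, together with `u`, is an abstract operator system on the complex vector space `V` with
involution `star`. For a finite-dimensional `V` with its unique Hausdorff vector space topology, the
(product) topology on `s × s` matrices is the finest locally convex one. Level `0` lives in the zero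
space, where these axioms force it to be `{0}`; so allowing `s = 0` changes nothing. -/
structure IsOperatorSystem [Star V] [TopologicalSpace V]
    (C : ∀ s : ℕ, Set (Matrix (Fin s) (Fin s) V)) (u : V) : Prop where
  isHermitian : ∀ s, ∀ A ∈ C s, A.IsHermitian
  add_mem : ∀ s, ∀ A ∈ C s, ∀ B ∈ C s, A + B ∈ C s
  smul_mem : ∀ s, ∀ r : ℝ, 0 ≤ r → ∀ A ∈ C s, (r : ℂ) • A ∈ C s
  isClosed : ∀ s, IsClosed (C s)
  salient : ∀ s, ∀ A ∈ C s, -A ∈ C s → A = 0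
  compress_mem : ∀ s t, ∀ A ∈ C s, ∀ W : Matrix (Fin s) (Fin t) ℂ, compress A W ∈ C t
  unit_mem : Matrix.diagonal (fun _ : Fin 1 => u) ∈ C 1
  orderUnit : ∀ s, ∀ A : Matrix (Fin s) (Fin s) V, A.IsHermitian →
    ∃ r : ℝ, (r : ℂ) • Matrix.diagonal (fun _ : Fin s => u) + A ∈ C s

/-- `C` is finitely generated: there are finitely many elements `A j` of `C` (at levels `s j`) such
that every operator system on `V` that contains all of them contains `C`. (For an operator system
`C` this says that `C` is the smallest operator system containing all the `A j`.) -/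
def FinitelyGenerated [Star V] [TopologicalSpace V]
    (C : ∀ s : ℕ, Set (Matrix (Fin s) (Fin s) V)) : Prop :=
  ∃ (n : ℕ) (s : Fin n → ℕ) (A : ∀ j, Matrix (Fin (s j)) (Fin (s j)) V),
    (∀ j, A j ∈ C (s j)) ∧
      ∀ (D : ∀ s : ℕ, Set (Matrix (Fin s) (Fin s) V)) (v : V), IsOperatorSystem D v →
        (∀ j, A j ∈ D (s j)) → ∀ t, C t ⊆ D t

/-- The operator on the Hilbert space `H ^ s` given by an `s × s` matrix of operators on `H`. -/
noncomputable def blockOperator {H : Type*} [NormedAddCommGroup H] [InnerProductSpace ℂ H] {s : ℕ}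
    (T : Matrix (Fin s) (Fin s) (H →L[ℂ] H)) :
    PiLp 2 (fun _ : Fin s => H) →L[ℂ] PiLp 2 (fun _ : Fin s => H) :=
  ((PiLp.continuousLinearEquiv 2 ℂ (fun _ : Fin s => H)).symm :
      (Fin s → H) →L[ℂ] PiLp 2 (fun _ : Fin s => H)) ∘L
    ContinuousLinearMap.pi fun k =>
      ∑ l, (T k l) ∘L (PiLp.proj 2 (fun _ : Fin s => H) l : PiLp 2 (fun _ : Fin s => H) →L[ℂ] H)

theorem blockOperator_apply {H : Type*} [NormedAddCommGroup H] [InnerProductSpace ℂ H] {s : ℕ}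
    (T : Matrix (Fin s) (Fin s) (H →L[ℂ] H)) (x : PiLp 2 (fun _ : Fin s => H)) (k : Fin s) :
    blockOperator T x k = ∑ l, T k l (x l) := by
  simp [blockOperator]

/-- A realization of `(C, u)` on the Hilbert space `H`: a `*`-linear map `φ : V → B(H)` with
`φ u = id`, such that a Hermitian matrix `A` over `V` lies in `C` iff `(φ ⊗ id) A ≥ 0`. -/
structure IsRealization [Star V] (C : ∀ s : ℕ, Set (Matrix (Fin s) (Fin s) V)) (u : V)
    {H : Type*} [NormedAddCommGroup H] [InnerProductSpace ℂ H] [CompleteSpace H]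
    (φ : V →ₗ[ℂ] (H →L[ℂ] H)) : Prop where
  map_star : ∀ v, φ (star v) = star (φ v)
  map_unit : φ u = ContinuousLinearMap.id ℂ H
  mem_iff : ∀ (s : ℕ) (A : Matrix (Fin s) (Fin s) V), A.IsHermitian →
    (A ∈ C s ↔ (blockOperator (A.map φ)).IsPositive)

/-- `(C, u)` has a realization on a finite-dimensional Hilbert space. -/
def FiniteDimRealizable [Star V] (C : ∀ s : ℕ, Set (Matrix (Fin s) (Fin s) V)) (u : V) : Prop :=
  ∃ (H : Type w) (_ : NormedAddCommGroup H) (_ : InnerProductSpace ℂ H) (_ : CompleteSpace H)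
    (_ : FiniteDimensional ℂ H) (φ : V →ₗ[ℂ] (H →L[ℂ] H)), IsRealization C u φ

/-- `C` is the free spectrahedron given by Hermitian `r × r` matrices, one for each member of a
basis of the Hermitian part of `V`; equivalently by the `*`-linear map `φ : V → Mat_r(ℂ)` taking
these values on the basis. No multiple of any `u` is required to be sent to the identity. -/
def IsFreeSpectrahedron [Star V] (C : ∀ s : ℕ, Set (Matrix (Fin s) (Fin s) V)) : Prop :=
  ∃ (r : ℕ) (φ : V →ₗ[ℂ] Matrix (Fin r) (Fin r) ℂ), (∀ v, φ (star v) = (φ v)ᴴ) ∧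
    ∀ (s : ℕ) (A : Matrix (Fin s) (Fin s) V),
      A ∈ C s ↔ A.IsHermitian ∧ (Matrix.comp _ _ _ _ ℂ (A.map φ)).PosSemidef

end General

/-! The operator systems over `V = Mat_d(ℂ)`, with level `s` inside `Mat_s(V) = Mat_d ⊗ Mat_s`. The
tensor `∑ i j, E i j ⊗ T i j` is the matrix over `V` whose `(k, l)` entry is `(i, j) ↦ T i j k l`;
`Matrix.comp` forgets the block structure. -/

/-- Positive semidefinite matrices. -/
def psd (d s : ℕ) : Set (Matrix (Fin s) (Fin s) (Matrix (Fin d) (Fin d) ℂ)) :=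
  {A | (Matrix.comp _ _ _ _ ℂ A).PosSemidef}

/-- The partial transpose, transposing the tensor factor `Mat_d`. -/
def partialTranspose {d s : ℕ} (A : Matrix (Fin s) (Fin s) (Matrix (Fin d) (Fin d) ℂ)) :
    Matrix (Fin s) (Fin s) (Matrix (Fin d) (Fin d) ℂ) :=
  A.map Matrix.transpose

/-- Matrices with positive semidefinite partial transpose. -/
def psdGamma (d s : ℕ) : Set (Matrix (Fin s) (Fin s) (Matrix (Fin d) (Fin d) ℂ)) :=
  {A | partialTranspose A ∈ psd d s}

/-- Doubly positive matrices. -/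
def dpsd (d s : ℕ) : Set (Matrix (Fin s) (Fin s) (Matrix (Fin d) (Fin d) ℂ)) :=
  psd d s ∩ psdGamma d s

/-- Decomposable matrices. -/
def decomp (d s : ℕ) : Set (Matrix (Fin s) (Fin s) (Matrix (Fin d) (Fin d) ℂ)) :=
  {A | ∃ X ∈ psd d s, ∃ Y ∈ psdGamma d s, A = X + Y}

/-- `T` is completely positive: `id_n ⊗ T` maps positive semidefinite matrices to such, for every
`n`. -/
def IsCompletelyPositive {d s : ℕ}
    (T : Matrix (Fin d) (Fin d) ℂ →ₗ[ℂ] Matrix (Fin s) (Fin s) ℂ) : Prop :=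
  ∀ (n : ℕ) (M : Matrix (Fin n) (Fin n) (Matrix (Fin d) (Fin d) ℂ)),
    (Matrix.comp _ _ _ _ ℂ M).PosSemidef → (Matrix.comp _ _ _ _ ℂ (M.map T)).PosSemidef

/-- `T` is doubly completely positive: `T` and `T ∘ transpose` are completely positive. -/
def IsDoublyCompletelyPositive {d s : ℕ}
    (T : Matrix (Fin d) (Fin d) ℂ →ₗ[ℂ] Matrix (Fin s) (Fin s) ℂ) : Prop :=
  IsCompletelyPositive T ∧
    IsCompletelyPositive (T ∘ₗ (Matrix.transposeLinearEquiv (Fin d) (Fin d) ℂ ℂ).toLinearMap)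

/-- A finitary Choi-type characterization of the doubly completely positive maps on `Mat_d(ℂ)`:
finitely many such maps `S j`, so that every such map has the form `X ↦ ∑ i, W_i* S_{j_i}(X) W_i`.
(Conversely, all maps of this form are doubly completely positive.) -/
def HasFinitaryChoiCharacterization (d : ℕ) : Prop :=
  ∃ (n : ℕ) (s : Fin n → ℕ)
    (S : ∀ j, Matrix (Fin d) (Fin d) ℂ →ₗ[ℂ] Matrix (Fin (s j)) (Fin (s j)) ℂ),
    (∀ j, IsDoublyCompletelyPositive (S j)) ∧
      ∀ (t : ℕ) (T : Matrix (Fin d) (Fin d) ℂ →ₗ[ℂ] Matrix (Fin t) (Fin t) ℂ),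
        IsDoublyCompletelyPositive T →
          ∃ (m : ℕ) (c : Fin m → Fin n) (W : ∀ i, Matrix (Fin (s (c i))) (Fin t) ℂ),
            ∀ X, T X = ∑ i, (W i)ᴴ * S (c i) X * W i

end OpSys

/-!
Everything rests on one obstruction. Let `S₁, …, Sₙ` be finitely many linear maps on `Mat_d(ℂ)`
whose Choi matrices are positive semidefinite both before and after partial transposition. For
real `μ` put `x = e_i + μ e_j` and `y = e_j - μ e_i`, where `i ≠ j`. Then for some `μ` and all
large real `r`, every `S_k` sends the indefinite matrix `Q = r y yᵀ - x xᵀ` to a positive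
semidefinite matrix (`exists_forall_posSemidef_witness`), although `xᵀ Q x < 0`.

To see this, put `a = 2 S(E_ii)`, `h = S(E_ij + E_ji)` and `c = 2 S(E_jj)`. Adding the corners of
the two Choi matrices shows that the block matrix `[a h; h c]` is positive semidefinite. A vector
`w` in the kernel of `2 S(y yᵀ) = c - 2μh + μ²a` thus gives a kernel vector `(-μw, w)` of the
block matrix, so `h w = μ a w`, and `a w ≠ 0` unless `S(x xᵀ) w = 0`. Solutions `w` of this pencil
equation for distinct real `μ` are orthogonal for the form `a`, so only finitely many `μ` occur
(`finite_setOf_ker_not_le`). For any other `μ` the kernel of `S_k(y yᵀ)` is contained in that of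
`S_k(x xᵀ)` for every `k`, and then `S_k(x xᵀ) ≤ r S_k(y yᵀ)` for large `r`.

The consequences:
* The map `φ` of a free spectrahedron equal to `decomp d` is such an `S`, as the Choi matrix and
  its partial transpose are decomposable; hence `φ(Q) ≥ 0` and `Q` would be decomposable, which at
  level one means positive semidefinite. A realization on a finite-dimensional Hilbert space
  becomes a free spectrahedron in an orthonormal basis.
* Elements of `dpsd d` are Choi matrices of such maps. The matrices `A ≥ 0` with
  `(tr_Q ⊗ id) A ≥ 0`, where `tr_Q(X) = ∑ i j, Q i j * X i j`, form an operator system (`isOperatorSystem_slice`;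
  the order unit is where `tr Q > 0` enters). It contains the given generators but not `x xᵀ`.
* The doubly completely positive functional `X ↦ xᵀ X x` is negative at `Q`, whereas every
  `X ↦ ∑ W_i* S_{j_i}(X) W_i` is positive semidefinite there.
-/

namespace OpSys

/-! ### Positive semidefinite matrices -/

section PosSemidef

variable {n m : Type*} [Fintype n] [Fintype m]

open scoped MatrixOrder in
theorem exists_forall_posSemidef_smul_one_add [DecidableEq n] {M : Matrix n n ℂ}
    (hM : M.IsHermitian) :
    ∃ R : ℝ, ∀ r : ℝ, R ≤ r → ((r : ℂ) • (1 : Matrix n n ℂ) + M).PosSemidef := by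
  open scoped Matrix.Norms.L2Operator in
  refine ⟨‖M‖, fun r hr => ?_⟩
  have h : -algebraMap ℝ (Matrix n n ℂ) ‖M‖ ≤ M := IsSelfAdjoint.neg_algebraMap_norm_le_self hM
  rw [Matrix.le_iff] at h
  have h1 : ((r - ‖M‖ : ℝ) : ℂ) • (1 : Matrix n n ℂ) |>.PosSemidef :=
    Matrix.PosSemidef.one.smul (by exact_mod_cast sub_nonneg.2 hr)
  convert h1.add h using 1
  rw [Algebra.algebraMap_eq_smul_one]
  ext i j
  simp [Matrix.add_apply, Matrix.smul_apply]
  ring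

open scoped MatrixOrder in
theorem exists_conjTranspose_mul_self {G : Matrix n n ℂ} (hG : G.PosSemidef) :
    ∃ B : Matrix n n ℂ, G = Bᴴ * B := by
  classical
  exact CStarAlgebra.nonneg_iff_eq_star_mul_self.1 hG.nonneg

theorem exists_mul_eq_of_mulVec_eq_zero [DecidableEq n] [DecidableEq m] {l : Type*}
    {B : Matrix m n ℂ} {C : Matrix l n ℂ} (h : ∀ w, B *ᵥ w = 0 → C *ᵥ w = 0) :
    ∃ Z : Matrix l m ℂ, C = Z * B := by
  have hk : LinearMap.ker B.mulVecLin ≤ LinearMap.ker C.mulVecLin := fun w hw => by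
    simpa using h w (by simpa using hw)
  obtain ⟨g, hg⟩ := LinearMap.exists_extend
    ((LinearMap.ker B.mulVecLin).liftQ C.mulVecLin hk ∘ₗ
      B.mulVecLin.quotKerEquivRange.symm.toLinearMap)
  refine ⟨LinearMap.toMatrix' g, ?_⟩
  apply Matrix.mulVec_injective
  funext w
  rw [← Matrix.mulVec_mulVec, LinearMap.toMatrix'_mulVec]
  have := congrArg (fun f => f ⟨B.mulVecLin w, LinearMap.mem_range_self _ w⟩) hg
  simp only [LinearMap.comp_apply, Submodule.subtype_apply, LinearEquiv.coe_coe] at this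
  rw [LinearMap.quotKerEquivRange_symm_apply_image B.mulVecLin w
    (LinearMap.mem_range_self _ w)] at this
  simpa using this.symm

/-- If the kernel of `G ≥ 0` is contained in that of `H ≥ 0`, then `H ≤ r G` for all large `r`:
writing `G = B* B` and `H = C* C`, the matrix `C` factors as `Z B`, and `Z* Z` is bounded. -/
theorem exists_forall_posSemidef_smul_sub [DecidableEq n] {G H : Matrix n n ℂ} (hG : G.PosSemidef)
    (hH : H.PosSemidef) (h : ∀ w, G *ᵥ w = 0 → H *ᵥ w = 0) :
    ∃ R : ℝ, ∀ r : ℝ, R ≤ r → ((r : ℂ) • G - H).PosSemidef := by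
  obtain ⟨B, rfl⟩ := exists_conjTranspose_mul_self hG
  obtain ⟨C, rfl⟩ := exists_conjTranspose_mul_self hH
  obtain ⟨Z, rfl⟩ : ∃ Z, C = Z * B := exists_mul_eq_of_mulVec_eq_zero fun w hw =>
    (Matrix.conjTranspose_mul_self_mulVec_eq_zero _ _).1
      (h w (by rw [← Matrix.mulVec_mulVec, hw, Matrix.mulVec_zero]))
  obtain ⟨R, hR⟩ := exists_forall_posSemidef_smul_one_add
    (Matrix.isHermitian_conjTranspose_mul_self Z).neg
  refine ⟨R, fun r hr => ?_⟩
  convert (hR r hr).conjTranspose_mul_mul_same B using 1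
  simp [Matrix.mul_add, Matrix.add_mul, Matrix.mul_assoc, sub_eq_add_neg]

/-- The Hermitian pencil `h - μ a` with `a ≥ 0` has only finitely many real eigenvalues `μ` with an
eigenvector outside the kernel of `a`, as such eigenvectors are orthogonal for the form `a`. -/
theorem finite_setOf_pencil_eigenvalue {a h : Matrix n n ℂ} (ha : a.PosSemidef)
    (hh : h.IsHermitian) :
    {μ : ℝ | ∃ w, h *ᵥ w = (μ : ℂ) • a *ᵥ w ∧ a *ᵥ w ≠ 0}.Finite := by
  obtain ⟨B, rfl⟩ := exists_conjTranspose_mul_self ha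
  choose! v hv hne using fun (μ : ℝ)
    (hμ : μ ∈ {μ : ℝ | ∃ w, h *ᵥ w = (μ : ℂ) • (Bᴴ * B) *ᵥ w ∧ (Bᴴ * B) *ᵥ w ≠ 0}) => hμ
  set s := {μ : ℝ | ∃ w, h *ᵥ w = (μ : ℂ) • (Bᴴ * B) *ᵥ w ∧ (Bᴴ * B) *ᵥ w ≠ 0}
  have hli : LinearIndependent ℂ fun μ : s => WithLp.toLp 2 (B *ᵥ v μ) := by
    refine linearIndependent_of_ne_zero_of_inner_eq_zero (fun μ h0 => ?_) fun μ ν hμν => ?_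
    · apply hne μ μ.2
      rw [← Matrix.mulVec_mulVec, (WithLp.toLp_injective 2 h0 : B *ᵥ v μ = 0), Matrix.mulVec_zero]
    · have key : ∀ x y : n → ℂ, inner ℂ (WithLp.toLp 2 (B *ᵥ x)) (WithLp.toLp 2 (B *ᵥ y)) =
          star x ⬝ᵥ (Bᴴ * B) *ᵥ y := fun x y => by
        rw [EuclideanSpace.inner_toLp_toLp, dotProduct_comm, Matrix.star_mulVec,
          ← Matrix.dotProduct_mulVec, Matrix.mulVec_mulVec]
      change inner ℂ _ _ = (0 : ℂ)
      rw [key]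
      have h1 : star (v μ) ⬝ᵥ h *ᵥ v ν = (ν : ℝ) * (star (v μ) ⬝ᵥ (Bᴴ * B) *ᵥ v ν) := by
        rw [hv ν ν.2, dotProduct_smul, smul_eq_mul]
      have h2 : star (v μ) ⬝ᵥ h *ᵥ v ν = (μ : ℝ) * (star (v μ) ⬝ᵥ (Bᴴ * B) *ᵥ v ν) := by
        rw [Matrix.dotProduct_mulVec, ← hh.eq, ← Matrix.star_mulVec, hv μ μ.2, star_smul,
          smul_dotProduct, Matrix.star_mulVec, ← Matrix.dotProduct_mulVec,
          (Matrix.isHermitian_conjTranspose_mul_self B).eq]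
        simp
      have h3 : ((ν : ℝ) - (μ : ℝ) : ℂ) * (star (v μ) ⬝ᵥ (Bᴴ * B) *ᵥ v ν) = 0 := by
        rw [sub_mul, ← h1, ← h2, sub_self]
      refine (mul_eq_zero.1 h3).resolve_left fun h4 => hμν ?_
      exact Subtype.ext (by exact_mod_cast (sub_eq_zero.1 h4).symm)
  exact hli.finite_of_isNoetherian

/-- For a positive semidefinite block matrix `[a h; h c]`, the compression by `(-μ, 1)` has its
kernel inside that of the compression by `(1, μ)`, for all but finitely many real `μ`. -/
theorem finite_setOf_ker_not_le {a h c : Matrix n n ℂ}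
    (hP : (Matrix.fromBlocks a h h c).PosSemidef) :
    {μ : ℝ | ∃ w, (c - (2 * μ : ℂ) • h + (μ ^ 2 : ℂ) • a) *ᵥ w = 0 ∧
      (a + (2 * μ : ℂ) • h + (μ ^ 2 : ℂ) • c) *ᵥ w ≠ 0}.Finite := by
  classical
  have ha : a.PosSemidef := hP.submatrix Sum.inl
  have hh : h.IsHermitian := (Matrix.isHermitian_fromBlocks_iff.1 hP.1).2.1
  refine (finite_setOf_pencil_eigenvalue ha hh).subset ?_
  rintro μ ⟨w, hG, hH⟩
  -- The quadratic form of the block matrix vanishes at `(-μ w, w)`, as its value there is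
  -- `w* (c - 2μh + μ²a) w`; by positivity this vector lies in the kernel.
  have hv : Matrix.fromBlocks a h h c *ᵥ Sum.elim (-(μ : ℂ) • w) w = 0 := by
    rw [← hP.dotProduct_mulVec_zero_iff, Matrix.fromBlocks_mulVec]
    have : star w ⬝ᵥ ((c - (2 * μ : ℂ) • h + (μ ^ 2 : ℂ) • a) *ᵥ w) = 0 := by simp [hG]
    have e : star (Sum.elim (-(μ : ℂ) • w) w) = Sum.elim (-(μ : ℂ) • star w) (star w) := by
      ext (i | i) <;> simp
    rw [e, sumElim_dotProduct_sumElim, ← this]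
    simp [Matrix.add_mulVec, Matrix.sub_mulVec, Matrix.smul_mulVec, Matrix.mulVec_smul,
      Matrix.mulVec_neg]
    ring
  rw [Matrix.fromBlocks_mulVec] at hv
  have h1 : h *ᵥ w = (μ : ℂ) • a *ᵥ w := by
    have := congrArg (fun f => f ∘ Sum.inl) hv
    simp only [Sum.elim_comp_inl, Sum.elim_comp_inr, Matrix.mulVec_smul] at this
    rw [eq_comm, ← sub_eq_zero, ← neg_eq_zero, neg_sub, sub_eq_neg_add, ← neg_smul]
    exact this
  have h2 : c *ᵥ w = (μ : ℂ) • h *ᵥ w := by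
    have := congrArg (fun f => f ∘ Sum.inr) hv
    simp only [Sum.elim_comp_inl, Sum.elim_comp_inr, Matrix.mulVec_smul] at this
    rw [eq_comm, ← sub_eq_zero, ← neg_eq_zero, neg_sub, sub_eq_neg_add, ← neg_smul]
    exact this
  refine ⟨w, h1, fun h0 => hH ?_⟩
  simp [Matrix.add_mulVec, Matrix.smul_mulVec, h2, h1, h0]

end PosSemidef

/-! ### The indefinite matrix with positive semidefinite images -/

theorem posSemidef_compress_fromBlocks {n : Type*} [Fintype n] {a h c : Matrix n n ℂ}
    (hP : (Matrix.fromBlocks a h h c).PosSemidef) (p q : ℝ) :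
    ((p ^ 2 : ℂ) • a + (2 * p * q : ℂ) • h + (q ^ 2 : ℂ) • c).PosSemidef := by
  classical
  convert hP.conjTranspose_mul_mul_same
    (Matrix.fromRows ((p : ℂ) • (1 : Matrix n n ℂ)) ((q : ℂ) • (1 : Matrix n n ℂ))) using 1
  rw [Matrix.conjTranspose_fromRows_eq_fromCols_conjTranspose, Matrix.fromCols_mul_fromBlocks,
    Matrix.fromCols_mul_fromRows]
  simp only [Matrix.conjTranspose_smul, Matrix.conjTranspose_one, smul_mul_assoc, mul_smul_comm,
    Matrix.one_mul, Matrix.mul_one, Complex.star_def, Complex.conj_ofReal]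
  module

theorem exists_forall_posSemidef_family {κ : Type*} [Finite κ] {n : κ → Type*} [∀ k, Fintype (n k)]
    {a h c : ∀ k, Matrix (n k) (n k) ℂ}
    (hP : ∀ k, (Matrix.fromBlocks (a k) (h k) (h k) (c k)).PosSemidef) :
    ∃ μ R : ℝ, ∀ r : ℝ, R ≤ r → ∀ k, ((r : ℂ) • (c k - (2 * μ : ℂ) • h k + (μ ^ 2 : ℂ) • a k) -
      (a k + (2 * μ : ℂ) • h k + (μ ^ 2 : ℂ) • c k)).PosSemidef := by
  classical
  obtain ⟨μ, hμ⟩ := (Set.finite_iUnion fun k => finite_setOf_ker_not_le (hP k)).exists_notMem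
  simp only [Set.mem_iUnion, Set.mem_ofPred_eq, not_exists, not_and, not_not] at hμ
  have hG : ∀ k, (c k - (2 * μ : ℂ) • h k + (μ ^ 2 : ℂ) • a k).PosSemidef := fun k => by
    convert posSemidef_compress_fromBlocks (hP k) (-μ) 1 using 1
    push_cast
    module
  have hH : ∀ k, (a k + (2 * μ : ℂ) • h k + (μ ^ 2 : ℂ) • c k).PosSemidef := fun k => by
    convert posSemidef_compress_fromBlocks (hP k) 1 μ using 1
    push_cast
    module
  choose R hR using fun k => exists_forall_posSemidef_smul_sub (hG k) (hH k) (hμ k)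
  obtain ⟨R', hR'⟩ := Finite.exists_le R
  exact ⟨μ, R', fun r hr k => hR k r ((hR' k).trans hr)⟩

/-- The matrix `∑ p q, E p q ⊗ E p q`; applying `S` to its entries gives the Choi matrix of `S`. -/
def choiMatrix (d : ℕ) : Matrix (Fin d) (Fin d) (Matrix (Fin d) (Fin d) ℂ) :=
  Matrix.of fun p q => Matrix.single p q 1

/-- The Choi matrices of `S` and of `X ↦ S Xᵀ` are positive semidefinite. -/
structure IsChoiDpsd {d : ℕ} {n : Type*} (S : Matrix (Fin d) (Fin d) ℂ →ₗ[ℂ] Matrix n n ℂ) :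
    Prop where
  posSemidef : (Matrix.comp _ _ _ _ ℂ ((choiMatrix d).map S)).PosSemidef
  posSemidef_partialTranspose :
    (Matrix.comp _ _ _ _ ℂ ((partialTranspose (choiMatrix d)).map S)).PosSemidef

/-- The vector `e_i + μ e_j`. For `i ≠ j`, the vector `planeVec j i (-μ)` is orthogonal to it. -/
def planeVec {d : ℕ} (i j : Fin d) (μ : ℝ) : Fin d → ℂ := Pi.single i 1 + Pi.single j (μ : ℂ)

/-- The matrix `r y yᵀ - x xᵀ` with `x = e_i + μ e_j` and `y = e_j - μ e_i`. For `i ≠ j` it is not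
positive semidefinite. -/
def witness {d : ℕ} (i j : Fin d) (μ r : ℝ) : Matrix (Fin d) (Fin d) ℂ :=
  (r : ℂ) • Matrix.vecMulVec (planeVec j i (-μ)) (planeVec j i (-μ)) -
    Matrix.vecMulVec (planeVec i j μ) (planeVec i j μ)

theorem vecMulVec_planeVec {d : ℕ} (i j : Fin d) (μ : ℝ) :
    Matrix.vecMulVec (planeVec i j μ) (planeVec i j μ) =
      Matrix.single i i 1 + (μ : ℂ) • (Matrix.single i j 1 + Matrix.single j i 1) +
        (μ ^ 2 : ℂ) • Matrix.single j j (1 : ℂ) := by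
  ext k l
  simp only [Matrix.vecMulVec_apply, planeVec, Pi.add_apply, Pi.single_apply, Matrix.add_apply,
    Matrix.smul_apply, Matrix.single_apply, smul_eq_mul, @eq_comm _ i k, @eq_comm _ j k,
    @eq_comm _ i l, @eq_comm _ j l]
  split_ifs <;> simp_all <;> ring

/-- The sum of the corners of the two Choi matrices. Symmetrizing makes the off-diagonal block
Hermitian. -/
theorem IsChoiDpsd.posSemidef_fromBlocks {d : ℕ} {n : Type*}
    {S : Matrix (Fin d) (Fin d) ℂ →ₗ[ℂ] Matrix n n ℂ} (hS : IsChoiDpsd S) (i j : Fin d) :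
    (Matrix.fromBlocks ((2 : ℂ) • S (Matrix.single i i 1))
      (S (Matrix.single i j 1 + Matrix.single j i 1))
      (S (Matrix.single i j 1 + Matrix.single j i 1))
      ((2 : ℂ) • S (Matrix.single j j 1))).PosSemidef := by
  let e : n ⊕ n → Fin d × n := Sum.elim (fun k => (i, k)) (fun k => (j, k))
  convert (hS.posSemidef.submatrix e).add (hS.posSemidef_partialTranspose.submatrix e) using 1
  ext (k | k) (l | l) <;>
    simp [e, choiMatrix, partialTranspose, two_mul, add_comm]

/-- Finitely many maps with doubly positive Choi matrices cannot detect that `witness i j μ r` is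
not positive semidefinite, for a suitable `μ` and large `r`. -/
theorem exists_forall_posSemidef_witness {d : ℕ} (i j : Fin d) {κ : Type*} [Finite κ]
    {n : κ → Type*} [∀ k, Fintype (n k)]
    {S : ∀ k, Matrix (Fin d) (Fin d) ℂ →ₗ[ℂ] Matrix (n k) (n k) ℂ}
    (hS : ∀ k, IsChoiDpsd (S k)) :
    ∃ μ R : ℝ, ∀ r : ℝ, R ≤ r → ∀ k, (S k (witness i j μ r)).PosSemidef := by
  obtain ⟨μ, R, h⟩ := exists_forall_posSemidef_family fun k => (hS k).posSemidef_fromBlocks i j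
  refine ⟨μ, R, fun r hr k => ?_⟩
  have h2 : (0 : ℂ) ≤ ((1 / 2 : ℝ) : ℂ) := by exact_mod_cast (by norm_num : (0 : ℝ) ≤ 1 / 2)
  convert (h r hr k).smul h2 using 1
  simp only [witness, vecMulVec_planeVec, map_sub, map_add, map_smul]
  push_cast
  module

theorem planeVec_dotProduct_self {d : ℕ} {i j : Fin d} (hij : i ≠ j) (μ : ℝ) :
    planeVec i j μ ⬝ᵥ planeVec i j μ = ((1 + μ ^ 2 : ℝ) : ℂ) := by
  simp [planeVec, hij, hij.symm, dotProduct_add]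
  ring

theorem planeVec_dotProduct_orthogonal {d : ℕ} {i j : Fin d} (hij : i ≠ j) (μ : ℝ) :
    planeVec i j μ ⬝ᵥ planeVec j i (-μ) = 0 := by
  simp [planeVec, hij, hij.symm, dotProduct_add]

theorem trace_witness {d : ℕ} {i j : Fin d} (hij : i ≠ j) (μ r : ℝ) :
    (witness i j μ r).trace = (((r - 1) * (1 + μ ^ 2) : ℝ) : ℂ) := by
  rw [witness, Matrix.trace_sub, Matrix.trace_smul, Matrix.trace_vecMulVec, Matrix.trace_vecMulVec,
    planeVec_dotProduct_self hij, planeVec_dotProduct_self hij.symm, smul_eq_mul]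
  push_cast
  ring

theorem dotProduct_witness_mulVec {d : ℕ} {i j : Fin d} (hij : i ≠ j) (μ r : ℝ) :
    planeVec i j μ ⬝ᵥ witness i j μ r *ᵥ planeVec i j μ = ((-(1 + μ ^ 2) ^ 2 : ℝ) : ℂ) := by
  rw [witness, Matrix.sub_mulVec, Matrix.smul_mulVec, Matrix.vecMulVec_mulVec,
    Matrix.vecMulVec_mulVec, planeVec_dotProduct_self hij, dotProduct_comm (planeVec j i (-μ)),
    planeVec_dotProduct_orthogonal hij]
  simp [planeVec_dotProduct_self hij]
  ring

theorem not_nonneg_dotProduct_witness_mulVec {d : ℕ} {i j : Fin d} (hij : i ≠ j) (μ r : ℝ) :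
    ¬ 0 ≤ planeVec i j μ ⬝ᵥ witness i j μ r *ᵥ planeVec i j μ := fun h => by
  rw [dotProduct_witness_mulVec hij] at h
  have h1 : 0 ≤ -(1 + μ ^ 2) ^ 2 := by exact_mod_cast h
  linarith [show 0 < (1 + μ ^ 2) ^ 2 by positivity]

theorem star_planeVec {d : ℕ} (i j : Fin d) (μ : ℝ) : star (planeVec i j μ) = planeVec i j μ := by
  ext k
  simp only [planeVec, Pi.star_apply, Pi.add_apply, Pi.single_apply, star_add]
  split_ifs <;> simp

/-! ### The operator systems of decomposable and of doubly positive matrices -/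

variable {d s t : ℕ}

theorem mem_psd {A : Matrix (Fin s) (Fin s) (Matrix (Fin d) (Fin d) ℂ)} :
    A ∈ psd d s ↔ (Matrix.comp _ _ _ _ ℂ A).PosSemidef := Iff.rfl

theorem mem_psdGamma {A : Matrix (Fin s) (Fin s) (Matrix (Fin d) (Fin d) ℂ)} :
    A ∈ psdGamma d s ↔ partialTranspose A ∈ psd d s := Iff.rfl

theorem isHermitian_comp_iff {A : Matrix (Fin s) (Fin s) (Matrix (Fin d) (Fin d) ℂ)} :
    (Matrix.comp _ _ _ _ ℂ A).IsHermitian ↔ A.IsHermitian := by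
  constructor
  · intro h
    ext k l i j
    exact congrFun (congrFun h (k, i)) (l, j)
  · intro h
    ext ⟨k, i⟩ ⟨l, j⟩
    exact congrFun (congrFun (congrFun (congrFun h k) l) i) j

theorem partialTranspose_partialTranspose (A : Matrix (Fin s) (Fin s) (Matrix (Fin d) (Fin d) ℂ)) :
    partialTranspose (partialTranspose A) = A := rfl

theorem isHermitian_partialTranspose_iff {A : Matrix (Fin s) (Fin s) (Matrix (Fin d) (Fin d) ℂ)} :
    (partialTranspose A).IsHermitian ↔ A.IsHermitian := by
  constructor <;>
  · intro h
    ext k l i j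
    exact congrFun (congrFun (congrFun (congrFun h k) l) j) i

theorem partialTranspose_compress (A : Matrix (Fin s) (Fin s) (Matrix (Fin d) (Fin d) ℂ))
    (W : Matrix (Fin s) (Fin t) ℂ) :
    partialTranspose (compress A W) = compress (partialTranspose A) W := by
  ext k l i j
  simp [partialTranspose, compress, Matrix.sum_apply]

theorem compress_add (A B : Matrix (Fin s) (Fin s) (Matrix (Fin d) (Fin d) ℂ))
    (W : Matrix (Fin s) (Fin t) ℂ) : compress (A + B) W = compress A W + compress B W := by
  ext k l i j
  simp [compress, Finset.sum_add_distrib]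

theorem partialTranspose_unit : partialTranspose
    (Matrix.diagonal fun _ : Fin s => (1 : Matrix (Fin d) (Fin d) ℂ)) =
      Matrix.diagonal fun _ => 1 := by
  rw [partialTranspose, Matrix.diagonal_map Matrix.transpose_zero]
  simp

open scoped Kronecker in
theorem compress_mem_psd {A : Matrix (Fin s) (Fin s) (Matrix (Fin d) (Fin d) ℂ)} (hA : A ∈ psd d s)
    (W : Matrix (Fin s) (Fin t) ℂ) : compress A W ∈ psd d t := by
  rw [mem_psd]
  convert hA.conjTranspose_mul_mul_same (W ⊗ₖ (1 : Matrix (Fin d) (Fin d) ℂ)) using 1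
  ext ⟨k, i⟩ ⟨l, j⟩
  simp only [Matrix.comp_apply, compress, Matrix.of_apply, Matrix.sum_apply, Matrix.smul_apply,
    Matrix.mul_apply, Matrix.conjTranspose_apply, Matrix.kroneckerMap_apply, Fintype.sum_prod_type,
    Matrix.one_apply, smul_eq_mul, apply_ite star, star_zero, mul_ite, ite_mul,
    mul_one, mul_zero, zero_mul, Finset.sum_ite_eq', Finset.mem_univ, if_true, Finset.sum_mul]
  rw [Finset.sum_comm]
  refine Finset.sum_congr rfl fun b _ => Finset.sum_congr rfl fun a _ => ?_
  ring

theorem add_mem_psd {A B : Matrix (Fin s) (Fin s) (Matrix (Fin d) (Fin d) ℂ)} (hA : A ∈ psd d s)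
    (hB : B ∈ psd d s) : A + B ∈ psd d s :=
  Matrix.PosSemidef.add hA hB

theorem smul_mem_psd {A : Matrix (Fin s) (Fin s) (Matrix (Fin d) (Fin d) ℂ)} (hA : A ∈ psd d s)
    {r : ℝ} (hr : 0 ≤ r) : (r : ℂ) • A ∈ psd d s :=
  Matrix.PosSemidef.smul hA (by exact_mod_cast hr : (0 : ℂ) ≤ (r : ℂ))

theorem zero_mem_psd : (0 : Matrix (Fin s) (Fin s) (Matrix (Fin d) (Fin d) ℂ)) ∈ psd d s :=
  Matrix.PosSemidef.zero

theorem comp_unit : Matrix.comp _ _ _ _ ℂ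
    (Matrix.diagonal fun _ : Fin s => (1 : Matrix (Fin d) (Fin d) ℂ)) = 1 :=
  Matrix.comp_one

theorem unit_mem_psd :
    (Matrix.diagonal fun _ : Fin s => (1 : Matrix (Fin d) (Fin d) ℂ)) ∈ psd d s := by
  rw [mem_psd, comp_unit]
  exact Matrix.PosSemidef.one

theorem exists_forall_smul_unit_add_mem_psd {A : Matrix (Fin s) (Fin s) (Matrix (Fin d) (Fin d) ℂ)}
    (hA : A.IsHermitian) : ∃ R : ℝ, ∀ r : ℝ, R ≤ r →
      (r : ℂ) • (Matrix.diagonal fun _ : Fin s => (1 : Matrix (Fin d) (Fin d) ℂ)) + A ∈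
        psd d s := by
  obtain ⟨R, hR⟩ := exists_forall_posSemidef_smul_one_add (isHermitian_comp_iff.2 hA)
  refine ⟨R, fun r hr => ?_⟩
  have := hR r hr
  rw [← comp_unit] at this
  exact this

theorem isClosed_setOf_posSemidef {n : Type*} [Fintype n] :
    IsClosed {M : Matrix n n ℂ | M.PosSemidef} := by
  have h : {M : Matrix n n ℂ | M.PosSemidef} =
      {M | Mᴴ = M} ∩ ⋂ x : n → ℂ, {M | 0 ≤ star x ⬝ᵥ M *ᵥ x} := by
    ext M
    simp [Matrix.posSemidef_iff_dotProduct_mulVec, Matrix.IsHermitian]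
  rw [h]
  exact (isClosed_eq (by fun_prop) continuous_id).inter (isClosed_iInter fun x =>
    isClosed_le continuous_const
      (continuous_const.dotProduct (continuous_id.matrix_mulVec continuous_const)))

theorem isClosed_psd : IsClosed (psd d s) := by
  refine isClosed_setOf_posSemidef.preimage ?_
  exact continuous_matrix fun a b => ((continuous_apply_apply a.1 b.1).matrix_elem a.2 b.2)

theorem continuous_partialTranspose : Continuous (partialTranspose (d := d) (s := s)) :=
  continuous_matrix fun a b => (continuous_apply_apply a b).matrix_transpose

theorem isClosed_psdGamma : IsClosed (psdGamma d s) :=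
  isClosed_psd.preimage continuous_partialTranspose

theorem norm_apply_le_trace {n : Type*} [Fintype n] {M : Matrix n n ℂ} (hM : M.PosSemidef)
    (i j : n) :
    ‖M i j‖ ≤ M.trace.re := by
  obtain ⟨B, rfl⟩ := exists_conjTranspose_mul_self hM
  have hdiag : ∀ i, ((Bᴴ * B) i i).re = ∑ k, ‖B k i‖ ^ 2 := fun i => by
    simp [Matrix.mul_apply, ← Complex.normSq_eq_conj_mul_self, Complex.normSq_eq_norm_sq,
      -Complex.ofReal_pow]
  have htr : ∀ i, ∑ k, ‖B k i‖ ^ 2 ≤ (Bᴴ * B).trace.re := fun i => by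
    rw [Matrix.trace, Complex.re_sum]
    simp only [Matrix.diag_apply, hdiag]
    exact Finset.single_le_sum (f := fun i => ∑ k, ‖B k i‖ ^ 2)
      (fun i _ => Finset.sum_nonneg fun k _ => sq_nonneg _) (Finset.mem_univ i)
  calc ‖(Bᴴ * B) i j‖ ≤ ∑ k, ‖B k i‖ * ‖B k j‖ := by
        rw [Matrix.mul_apply]
        exact norm_sum_le_of_le _ fun k _ => by simp
    _ ≤ ∑ k, (‖B k i‖ ^ 2 + ‖B k j‖ ^ 2) / 2 := Finset.sum_le_sum fun k _ => by
        linarith [two_mul_le_add_sq ‖B k i‖ ‖B k j‖]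
    _ ≤ (Bᴴ * B).trace.re := by
        rw [← Finset.sum_div, Finset.sum_add_distrib]
        linarith [htr i, htr j]

theorem continuous_trace_comp_re :
    Continuous fun A : Matrix (Fin s) (Fin s) (Matrix (Fin d) (Fin d) ℂ) =>
      (Matrix.comp _ _ _ _ ℂ A).trace.re := by
  refine Complex.continuous_re.comp (Continuous.matrix_trace ?_)
  exact continuous_matrix fun a b => ((continuous_apply_apply a.1 b.1).matrix_elem a.2 b.2)

theorem isCompact_psd_inter (R : ℝ) :
    IsCompact {A : Matrix (Fin s) (Fin s) (Matrix (Fin d) (Fin d) ℂ) |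
      A ∈ psd d s ∧ (Matrix.comp _ _ _ _ ℂ A).trace.re ≤ R} := by
  have hK : IsCompact (Set.pi Set.univ fun _ : Fin s => Set.pi Set.univ fun _ : Fin s =>
      Set.pi Set.univ fun _ : Fin d => Set.pi Set.univ fun _ : Fin d =>
        Metric.closedBall (0 : ℂ) R) :=
    isCompact_univ_pi fun _ => isCompact_univ_pi fun _ => isCompact_univ_pi fun _ =>
      isCompact_univ_pi fun _ => isCompact_closedBall _ _
  refine hK.of_isClosed_subset 
    (isClosed_psd.inter (isClosed_le continuous_trace_comp_re continuous_const)) ?_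
  rintro A ⟨hA, hR⟩ k - l - i - j -
  rw [mem_closedBall_zero_iff]
  exact (norm_apply_le_trace hA (k, i) (l, j)).trans hR

theorem trace_comp_partialTranspose (A : Matrix (Fin s) (Fin s) (Matrix (Fin d) (Fin d) ℂ)) :
    (Matrix.comp _ _ _ _ ℂ (partialTranspose A)).trace = (Matrix.comp _ _ _ _ ℂ A).trace := rfl

theorem trace_comp_add (A B : Matrix (Fin s) (Fin s) (Matrix (Fin d) (Fin d) ℂ)) :
    (Matrix.comp _ _ _ _ ℂ (A + B)).trace =
      (Matrix.comp _ _ _ _ ℂ A).trace + (Matrix.comp _ _ _ _ ℂ B).trace :=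
  Matrix.trace_add (Matrix.comp _ _ _ _ ℂ A) (Matrix.comp _ _ _ _ ℂ B)

open Filter Topology in
/-- If `X + Y` converges, then the traces, and with them the entries, of the summands stay
bounded, so that `X` has a limit along an ultrafilter. -/
theorem isClosed_decomp : IsClosed (decomp d s) := by
  rw [isClosed_iff_ultrafilter]
  intro A u hu hmem
  choose! X hX Y hY hXY using fun (A) (hA : A ∈ decomp d s) => hA
  set R := (Matrix.comp _ _ _ _ ℂ A).trace.re + 1
  have hR : ∀ᶠ B in (u : Filter (Matrix (Fin s) (Fin s) (Matrix (Fin d) (Fin d) ℂ))),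
      (Matrix.comp _ _ _ _ ℂ B).trace.re < R :=
    hu ((continuous_trace_comp_re.tendsto A).eventually (gt_mem_nhds (lt_add_one _)))
  have hK : {A | A ∈ psd d s ∧ (Matrix.comp _ _ _ _ ℂ A).trace.re ≤ R} ∈ u.map X := by
    rw [Ultrafilter.mem_map]
    filter_upwards [hR, hmem] with B hB hBd
    refine ⟨hX B hBd, le_trans ?_ hB.le⟩
    have h0 := (Complex.nonneg_iff.1 (Matrix.PosSemidef.trace_nonneg (hY B hBd))).1
    rw [trace_comp_partialTranspose] at h0
    conv_rhs => rw [hXY B hBd, trace_comp_add, Complex.add_re]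
    linarith
  obtain ⟨X₀, hX₀, hle⟩ := (isCompact_psd_inter R).ultrafilter_le_nhds' _ hK
  refine ⟨X₀, hX₀.1, A - X₀, ?_, by abel⟩
  have hlim : Tendsto (fun B => B - X B) u (𝓝 (A - X₀)) := Tendsto.sub hu hle
  refine isClosed_psdGamma.mem_of_tendsto hlim ?_
  filter_upwards [hmem] with B hB
  convert hY B hB using 1
  nth_rw 1 [hXY B hB]
  abel

theorem trace_nonneg_of_mem_decomp {A : Matrix (Fin s) (Fin s) (Matrix (Fin d) (Fin d) ℂ)}
    (hA : A ∈ decomp d s) : 0 ≤ (Matrix.comp _ _ _ _ ℂ A).trace ∧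
      ((Matrix.comp _ _ _ _ ℂ A).trace = 0 → A = 0) := by
  obtain ⟨X, hX, Y, hY, rfl⟩ := hA
  have h1 := Matrix.PosSemidef.trace_nonneg hX
  have h2 := Matrix.PosSemidef.trace_nonneg hY
  rw [trace_comp_partialTranspose] at h2
  rw [trace_comp_add]
  refine ⟨add_nonneg h1 h2, fun h => ?_⟩
  rw [add_eq_zero_iff_of_nonneg h1 h2] at h
  have hX0 : X = 0 := (Matrix.comp _ _ _ _ ℂ).injective
    ((Matrix.PosSemidef.trace_eq_zero_iff hX).1 h.1)
  have hY0 : partialTranspose Y = 0 := (Matrix.comp _ _ _ _ ℂ).injective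
    ((Matrix.PosSemidef.trace_eq_zero_iff hY).1 h.2)
  have hY0' : Y = 0 := by
    rw [← partialTranspose_partialTranspose Y, hY0]
    rfl
  rw [hX0, hY0', add_zero]

theorem eq_zero_of_mem_decomp_of_neg_mem {A : Matrix (Fin s) (Fin s) (Matrix (Fin d) (Fin d) ℂ)}
    (hA : A ∈ decomp d s) (hA' : -A ∈ decomp d s) : A = 0 := by
  refine (trace_nonneg_of_mem_decomp hA).2 (le_antisymm ?_ (trace_nonneg_of_mem_decomp hA).1)
  have h : 0 ≤ (-Matrix.comp _ _ _ _ ℂ A).trace := (trace_nonneg_of_mem_decomp hA').1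
  rw [Matrix.trace_neg] at h
  exact neg_nonneg.1 h

theorem psd_subset_decomp : psd d s ⊆ decomp d s := fun A hA =>
  ⟨A, hA, 0, zero_mem_psd, (add_zero A).symm⟩

theorem psdGamma_subset_decomp : psdGamma d s ⊆ decomp d s := fun A hA =>
  ⟨0, zero_mem_psd, A, hA, (zero_add A).symm⟩

theorem isHermitian_of_mem_psd {A : Matrix (Fin s) (Fin s) (Matrix (Fin d) (Fin d) ℂ)}
    (hA : A ∈ psd d s) : A.IsHermitian := isHermitian_comp_iff.1 hA.1

theorem isOperatorSystem_decomp : IsOperatorSystem (decomp d) (1 : Matrix (Fin d) (Fin d) ℂ) where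
  isHermitian := by
    rintro s _ ⟨X, hX, Y, hY, rfl⟩
    exact (isHermitian_of_mem_psd hX).add
      (isHermitian_partialTranspose_iff.1 (isHermitian_of_mem_psd hY))
  add_mem := by
    rintro s _ ⟨X, hX, Y, hY, rfl⟩ _ ⟨X', hX', Y', hY', rfl⟩
    exact ⟨X + X', add_mem_psd hX hX', Y + Y', add_mem_psd hY hY', by abel⟩
  smul_mem := by
    rintro s r hr _ ⟨X, hX, Y, hY, rfl⟩
    exact ⟨(r : ℂ) • X, smul_mem_psd hX hr, (r : ℂ) • Y, smul_mem_psd hY hr, smul_add _ _ _⟩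
  isClosed _ := isClosed_decomp
  salient _ _ := eq_zero_of_mem_decomp_of_neg_mem
  compress_mem := by
    rintro s t _ ⟨X, hX, Y, hY, rfl⟩ W
    refine ⟨compress X W, compress_mem_psd hX W, compress Y W, ?_, compress_add X Y W⟩
    rw [mem_psdGamma, partialTranspose_compress]
    exact compress_mem_psd hY W
  unit_mem := psd_subset_decomp unit_mem_psd
  orderUnit s A hA := by
    obtain ⟨R, hR⟩ := exists_forall_smul_unit_add_mem_psd hA
    exact ⟨R, psd_subset_decomp (hR R le_rfl)⟩

theorem isOperatorSystem_dpsd : IsOperatorSystem (dpsd d) (1 : Matrix (Fin d) (Fin d) ℂ) where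
  isHermitian s A hA := isHermitian_of_mem_psd hA.1
  add_mem s A hA B hB := ⟨add_mem_psd hA.1 hB.1, add_mem_psd hA.2 hB.2⟩
  smul_mem s r hr A hA := ⟨smul_mem_psd hA.1 hr, smul_mem_psd hA.2 hr⟩
  isClosed _ := isClosed_psd.inter isClosed_psdGamma
  salient _ _ hA hA' := eq_zero_of_mem_decomp_of_neg_mem (psd_subset_decomp hA.1)
    (psd_subset_decomp hA'.1)
  compress_mem s t A hA W := by
    refine ⟨compress_mem_psd hA.1 W, ?_⟩
    rw [mem_psdGamma, partialTranspose_compress]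
    exact compress_mem_psd hA.2 W
  unit_mem := by
    refine ⟨unit_mem_psd, ?_⟩
    rw [mem_psdGamma, partialTranspose_unit]
    exact unit_mem_psd
  orderUnit s A hA := by
    obtain ⟨R, hR⟩ := exists_forall_smul_unit_add_mem_psd hA
    obtain ⟨R', hR'⟩ := exists_forall_smul_unit_add_mem_psd (isHermitian_partialTranspose_iff.2 hA)
    refine ⟨max R R', hR _ (le_max_left _ _), ?_⟩
    have := hR' _ (le_max_right R R')
    rw [← partialTranspose_unit] at this
    exact this

/-! ### Maps given by their Choi matrices -/

/-- The map `Mat_d → Mat_s` with Choi matrix `A`: it sends `E i j` to the matrix with `(k, l)` entry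
`A k l i j`. As a function of `A`, this is `tr_X ⊗ id` with `tr_X(Z) = ∑ i j, X i j * Z i j`. -/
def slice (A : Matrix (Fin s) (Fin s) (Matrix (Fin d) (Fin d) ℂ)) :
    Matrix (Fin d) (Fin d) ℂ →ₗ[ℂ] Matrix (Fin s) (Fin s) ℂ where
  toFun X := Matrix.of fun k l => ∑ i, ∑ j, X i j * A k l i j
  map_add' X Y := by
    ext k l
    simp [add_mul, Finset.sum_add_distrib]
  map_smul' c X := by
    ext k l
    simp [mul_assoc, Finset.mul_sum]

theorem slice_apply (A : Matrix (Fin s) (Fin s) (Matrix (Fin d) (Fin d) ℂ))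
    (X : Matrix (Fin d) (Fin d) ℂ) (k l : Fin s) :
    slice A X k l = ∑ i, ∑ j, X i j * A k l i j := rfl

theorem slice_add (A B : Matrix (Fin s) (Fin s) (Matrix (Fin d) (Fin d) ℂ))
    (X : Matrix (Fin d) (Fin d) ℂ) : slice (A + B) X = slice A X + slice B X := by
  ext k l
  simp [slice_apply, mul_add, Finset.sum_add_distrib]

theorem slice_smul (c : ℂ) (A : Matrix (Fin s) (Fin s) (Matrix (Fin d) (Fin d) ℂ))
    (X : Matrix (Fin d) (Fin d) ℂ) : slice (c • A) X = c • slice A X := by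
  ext k l
  simp [slice_apply, Finset.mul_sum, mul_left_comm]

theorem slice_unit (X : Matrix (Fin d) (Fin d) ℂ) :
    slice (Matrix.diagonal fun _ : Fin s => (1 : Matrix (Fin d) (Fin d) ℂ)) X =
      X.trace • (1 : Matrix (Fin s) (Fin s) ℂ) := by
  ext k l
  rcases eq_or_ne k l with rfl | h
  · simp [slice_apply, Matrix.one_apply, Matrix.trace]
  · simp [slice_apply, h]

theorem slice_compress (A : Matrix (Fin s) (Fin s) (Matrix (Fin d) (Fin d) ℂ))
    (W : Matrix (Fin s) (Fin t) ℂ) (X : Matrix (Fin d) (Fin d) ℂ) :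
    slice (compress A W) X = Wᴴ * slice A X * W := by
  ext k l
  simp only [slice_apply, compress, Matrix.of_apply, Matrix.sum_apply, Matrix.smul_apply,
    Matrix.mul_apply, Matrix.conjTranspose_apply, smul_eq_mul, Finset.mul_sum, Finset.sum_mul]
  have h : ∀ f : Fin d → Fin d → Fin s → Fin s → ℂ,
      ∑ i, ∑ j, ∑ a, ∑ b, f i j a b = ∑ b, ∑ a, ∑ i, ∑ j, f i j a b := fun f => by
    calc _ = ∑ i, ∑ a, ∑ j, ∑ b, f i j a b := Finset.sum_congr rfl fun i _ => Finset.sum_comm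
      _ = ∑ a, ∑ i, ∑ j, ∑ b, f i j a b := Finset.sum_comm
      _ = ∑ a, ∑ i, ∑ b, ∑ j, f i j a b := Finset.sum_congr rfl fun a _ =>
          Finset.sum_congr rfl fun i _ => Finset.sum_comm
      _ = ∑ a, ∑ b, ∑ i, ∑ j, f i j a b := Finset.sum_congr rfl fun a _ => Finset.sum_comm
      _ = _ := Finset.sum_comm
  rw [h]
  refine Finset.sum_congr rfl fun b _ => Finset.sum_congr rfl fun a _ => Finset.sum_congr rfl
    fun i _ => Finset.sum_congr rfl fun j _ => ?_
  ring

theorem isHermitian_slice {A : Matrix (Fin s) (Fin s) (Matrix (Fin d) (Fin d) ℂ)}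
    (hA : A.IsHermitian) {X : Matrix (Fin d) (Fin d) ℂ} (hX : X.IsHermitian) :
    (slice A X).IsHermitian := by
  ext k l
  rw [Matrix.conjTranspose_apply, slice_apply, slice_apply]
  simp only [star_sum]
  rw [Finset.sum_comm]
  refine Finset.sum_congr rfl fun i _ => Finset.sum_congr rfl fun j _ => ?_
  rw [star_mul', hX.apply]
  congr 1
  exact congrFun (congrFun (congrFun (congrFun hA k) l) i) j

theorem slice_partialTranspose (A : Matrix (Fin s) (Fin s) (Matrix (Fin d) (Fin d) ℂ))
    (X : Matrix (Fin d) (Fin d) ℂ) : slice (partialTranspose A) X = slice A Xᵀ := by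
  ext k l
  rw [slice_apply, slice_apply, Finset.sum_comm]
  rfl

theorem continuous_slice (X : Matrix (Fin d) (Fin d) ℂ) :
    Continuous fun A : Matrix (Fin s) (Fin s) (Matrix (Fin d) (Fin d) ℂ) => slice A X :=
  continuous_matrix fun k l => by
    simp only [slice_apply]
    exact continuous_finsetSum _ fun i _ => continuous_finsetSum _ fun j _ =>
      continuous_const.mul ((continuous_apply_apply k l).matrix_elem i j)

theorem slice_single (A : Matrix (Fin s) (Fin s) (Matrix (Fin d) (Fin d) ℂ)) (p q : Fin d)
    (k l : Fin s) : slice A (Matrix.single p q 1) k l = A k l p q := by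
  simp [slice_apply, Matrix.single_apply, ite_and]

theorem posSemidef_slice {A : Matrix (Fin s) (Fin s) (Matrix (Fin d) (Fin d) ℂ)} (hA : A ∈ psd d s)
    {x : Fin d → ℂ} (hx : star x = x) : (slice A (Matrix.vecMulVec x x)).PosSemidef := by
  convert hA.conjTranspose_mul_mul_same
    (Matrix.of fun (a : Fin s × Fin d) (k : Fin s) => if a.1 = k then x a.2 else 0) using 1
  have hx' : ∀ i, (starRingEnd ℂ) (x i) = x i := fun i => congrFun hx i
  ext k l
  simp [slice_apply, Matrix.mul_apply, Fintype.sum_prod_type, apply_ite, Finset.sum_mul,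
    Matrix.vecMulVec_apply, hx']
  rw [Finset.sum_comm]
  refine Finset.sum_congr rfl fun b _ => Finset.sum_congr rfl fun a _ => ?_
  ring

theorem isChoiDpsd_slice {A : Matrix (Fin s) (Fin s) (Matrix (Fin d) (Fin d) ℂ)}
    (hA : A ∈ dpsd d s) : IsChoiDpsd (slice A) where
  posSemidef := by
    convert hA.1.submatrix Prod.swap using 1
    ext ⟨p, k⟩ ⟨q, l⟩
    exact slice_single A p q k l
  posSemidef_partialTranspose := by
    convert hA.2.submatrix Prod.swap using 1
    ext ⟨p, k⟩ ⟨q, l⟩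
    have h : partialTranspose (choiMatrix d) p q = Matrix.single q p 1 :=
      Matrix.transpose_single _ _ _
    change slice A (partialTranspose (choiMatrix d) p q) k l = A k l q p
    rw [h, slice_single]

theorem choiMatrix_mem_psd : choiMatrix d ∈ psd d d := by
  rw [mem_psd]
  convert Matrix.posSemidef_vecMulVec_self_star
    (fun a : Fin d × Fin d => if a.1 = a.2 then (1 : ℂ) else 0) using 1
  ext ⟨p, i⟩ ⟨q, j⟩
  rcases eq_or_ne p i with rfl | h <;> rcases eq_or_ne q j with rfl | h' <;>
    simp [choiMatrix, Matrix.vecMulVec_apply, *]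

theorem partialTranspose_choiMatrix_mem_psdGamma :
    partialTranspose (choiMatrix d) ∈ psdGamma d d := choiMatrix_mem_psd

theorem IsDoublyCompletelyPositive.isChoiDpsd
    {T : Matrix (Fin d) (Fin d) ℂ →ₗ[ℂ] Matrix (Fin s) (Fin s) ℂ}
    (hT : IsDoublyCompletelyPositive T) : IsChoiDpsd T :=
  ⟨hT.1 d _ choiMatrix_mem_psd, hT.2 d _ choiMatrix_mem_psd⟩

theorem isHermitian_witness (i j : Fin d) (μ r : ℝ) : (witness i j μ r).IsHermitian := by
  rw [Matrix.IsHermitian, witness, Matrix.conjTranspose_sub, Matrix.conjTranspose_smul,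
    Matrix.conjTranspose_vecMulVec, Matrix.conjTranspose_vecMulVec, star_planeVec, star_planeVec]
  simp

theorem slice_vecMulVec_apply (X : Matrix (Fin d) (Fin d) ℂ) (x : Fin d → ℂ) :
    slice (Matrix.of fun _ _ : Fin 1 => X) (Matrix.vecMulVec x x) 0 0 = x ⬝ᵥ X *ᵥ x := by
  simp [slice_apply, Matrix.vecMulVec_apply, dotProduct, Matrix.mulVec, Finset.mul_sum]
  refine Finset.sum_congr rfl fun b _ => Finset.sum_congr rfl fun a _ => ?_
  ring

theorem slice_of_vecMulVec_apply (X : Matrix (Fin d) (Fin d) ℂ) (x : Fin d → ℂ) :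
    slice (Matrix.of fun _ _ : Fin 1 => Matrix.vecMulVec x x) X 0 0 = x ⬝ᵥ X *ᵥ x := by
  rw [← slice_vecMulVec_apply]
  simp [slice_apply, mul_comm]

theorem partialTranspose_rankOne (x : Fin d → ℂ) :
    partialTranspose (Matrix.of fun _ _ : Fin 1 => Matrix.vecMulVec x x) =
      Matrix.of fun _ _ : Fin 1 => Matrix.vecMulVec x x := by
  ext1 k l
  exact Matrix.transpose_vecMulVec x x

theorem rankOne_mem_dpsd {x : Fin d → ℂ} (hx : star x = x) :
    (Matrix.of fun _ _ : Fin 1 => Matrix.vecMulVec x x) ∈ dpsd d 1 := by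
  have h : (Matrix.of fun _ _ : Fin 1 => Matrix.vecMulVec x x) ∈ psd d 1 := by
    have := (Matrix.posSemidef_vecMulVec_self_star x).submatrix (Prod.snd : Fin 1 × Fin d → Fin d)
    rw [hx] at this
    exact this
  refine ⟨h, ?_⟩
  rw [mem_psdGamma, partialTranspose_rankOne]
  exact h

/-- At level one decomposable matrices are positive semidefinite; only real vectors are considered,
for which the transpose of `x xᵀ` is `x xᵀ` itself. -/
theorem nonneg_of_mem_decomp_one {X : Matrix (Fin d) (Fin d) ℂ}
    (hX : (Matrix.of fun _ _ : Fin 1 => X) ∈ decomp d 1) {x : Fin d → ℂ} (hx : star x = x) :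
    0 ≤ x ⬝ᵥ X *ᵥ x := by
  obtain ⟨Y, hY, Z, hZ, h⟩ := hX
  rw [← slice_vecMulVec_apply, h, slice_add]
  have hZ' := posSemidef_slice hZ hx
  rw [slice_partialTranspose, Matrix.transpose_vecMulVec] at hZ'
  exact ((posSemidef_slice hY hx).add hZ').diag_nonneg

/-- The operator system, for Hermitian `Q` with positive trace, of the `A ≥ 0` with
`(tr_Q ⊗ id) A ≥ 0`. -/
theorem isOperatorSystem_slice {Q : Matrix (Fin d) (Fin d) ℂ} (hQ : Q.IsHermitian) {q : ℝ}
    (hq : 0 < q) (htr : Q.trace = q) :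
    IsOperatorSystem (fun s => {A | A ∈ psd d s ∧ (slice A Q).PosSemidef}) 1 where
  isHermitian s A hA := isHermitian_of_mem_psd hA.1
  add_mem s A hA B hB := ⟨add_mem_psd hA.1 hB.1, by rw [slice_add]; exact hA.2.add hB.2⟩
  smul_mem s r hr A hA := ⟨smul_mem_psd hA.1 hr, by
    rw [slice_smul]; exact hA.2.smul (by exact_mod_cast hr)⟩
  isClosed s := isClosed_psd.inter (isClosed_setOf_posSemidef.preimage (continuous_slice Q))
  salient _ _ hA hA' := eq_zero_of_mem_decomp_of_neg_mem (psd_subset_decomp hA.1)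
    (psd_subset_decomp hA'.1)
  compress_mem s t A hA W := ⟨compress_mem_psd hA.1 W, by
    rw [slice_compress]; exact hA.2.conjTranspose_mul_mul_same W⟩
  unit_mem := ⟨unit_mem_psd, by
    rw [slice_unit, htr]; exact Matrix.PosSemidef.one.smul (by exact_mod_cast hq.le)⟩
  orderUnit s A hA := by
    obtain ⟨R, hR⟩ := exists_forall_smul_unit_add_mem_psd hA
    obtain ⟨R', hR'⟩ := exists_forall_posSemidef_smul_one_add (isHermitian_slice hA hQ)
    refine ⟨max R (R' / q), hR _ (le_max_left _ _), ?_⟩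
    have := hR' (max R (R' / q) * q) ((div_le_iff₀ hq).1 (le_max_right _ _))
    rw [slice_add, slice_smul, slice_unit, htr, smul_smul, ← Complex.ofReal_mul]
    exact this

/-! ### Impossibility of finite descriptions -/

theorem not_finitelyGenerated_dpsd (hd : 2 ≤ d) : ¬ FinitelyGenerated (dpsd d) := by
  rintro ⟨n, s, A, hA, hgen⟩
  let i : Fin d := ⟨0, by omega⟩
  let j : Fin d := ⟨1, by omega⟩
  have hij : i ≠ j := by simp [i, j]
  obtain ⟨μ, R, hR⟩ := exists_forall_posSemidef_witness i j fun k => isChoiDpsd_slice (hA k)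
  -- `r ≥ 2` makes the trace of `witness i j μ r` positive.
  set r := max R 2
  have hq : 0 < (r - 1) * (1 + μ ^ 2) :=
    mul_pos (by linarith [le_max_right R 2]) (by positivity)
  have hmem := hgen _ _ (isOperatorSystem_slice (isHermitian_witness i j μ r) hq
    (trace_witness hij μ r)) (fun k => ⟨(hA k).1, hR r (le_max_left _ _) k⟩) 1
    (rankOne_mem_dpsd (star_planeVec i j μ))
  have h0 := hmem.2.diag_nonneg (i := 0)
  rw [slice_of_vecMulVec_apply] at h0
  exact not_nonneg_dotProduct_witness_mulVec hij μ _ h0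

theorem isDoublyCompletelyPositive_slice_rankOne {x : Fin d → ℂ} (hx : star x = x) :
    IsDoublyCompletelyPositive (slice (Matrix.of fun _ _ : Fin 1 => Matrix.vecMulVec x x)) := by
  have h : IsCompletelyPositive (slice (Matrix.of fun _ _ : Fin 1 => Matrix.vecMulVec x x)) := by
    intro n M hM
    have heq : Matrix.comp _ _ _ _ ℂ
        (M.map (slice (Matrix.of fun _ _ : Fin 1 => Matrix.vecMulVec x x))) =
        (slice M (Matrix.vecMulVec x x)).submatrix Prod.fst Prod.fst := by
      ext ⟨k, a⟩ ⟨l, b⟩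
      rw [Matrix.comp_apply, Matrix.map_apply, Matrix.submatrix_apply, slice_apply, slice_apply]
      exact Finset.sum_congr rfl fun i _ => Finset.sum_congr rfl fun j _ => mul_comm _ _
    rw [heq]
    exact (posSemidef_slice hM hx).submatrix Prod.fst
  have heq : slice (Matrix.of fun _ _ : Fin 1 => Matrix.vecMulVec x x) ∘ₗ
      (Matrix.transposeLinearEquiv (Fin d) (Fin d) ℂ ℂ).toLinearMap =
      slice (Matrix.of fun _ _ : Fin 1 => Matrix.vecMulVec x x) := by
    refine LinearMap.ext fun X => ?_
    have hX : (Matrix.transposeLinearEquiv (Fin d) (Fin d) ℂ ℂ).toLinearMap X = Xᵀ := rfl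
    rw [LinearMap.comp_apply, hX, ← slice_partialTranspose, partialTranspose_rankOne]
  rw [IsDoublyCompletelyPositive, heq]
  exact ⟨h, h⟩

theorem not_hasFinitaryChoiCharacterization (hd : 2 ≤ d) : ¬ HasFinitaryChoiCharacterization d := by
  rintro ⟨n, s, S, hS, hgen⟩
  let i : Fin d := ⟨0, by omega⟩
  let j : Fin d := ⟨1, by omega⟩
  have hij : i ≠ j := by simp [i, j]
  obtain ⟨μ, R, hR⟩ := exists_forall_posSemidef_witness i j fun k => (hS k).isChoiDpsd
  obtain ⟨m, c, W, hW⟩ := hgen 1 _ (isDoublyCompletelyPositive_slice_rankOne (star_planeVec i j μ))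
  have h : (∑ k, (W k)ᴴ * S (c k) (witness i j μ R) * W k).PosSemidef :=
    Matrix.posSemidef_sum _ fun k _ => (hR R le_rfl (c k)).conjTranspose_mul_mul_same (W k)
  rw [← hW] at h
  have h0 := h.diag_nonneg (i := 0)
  rw [slice_of_vecMulVec_apply] at h0
  exact not_nonneg_dotProduct_witness_mulVec hij μ _ h0

theorem not_isFreeSpectrahedron_decomp (hd : 2 ≤ d) : ¬ IsFreeSpectrahedron (decomp d) := by
  rintro ⟨n, φ, -, hφ⟩
  let i : Fin d := ⟨0, by omega⟩
  let j : Fin d := ⟨1, by omega⟩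
  have hij : i ≠ j := by simp [i, j]
  have hφ' : IsChoiDpsd φ := ⟨((hφ d _).1 (psd_subset_decomp choiMatrix_mem_psd)).2,
    ((hφ d _).1 (psdGamma_subset_decomp partialTranspose_choiMatrix_mem_psdGamma)).2⟩
  obtain ⟨μ, R, hR⟩ := exists_forall_posSemidef_witness i j fun _ : Unit => hφ'
  have hmem : (Matrix.of fun _ _ : Fin 1 => witness i j μ R) ∈ decomp d 1 := by
    rw [hφ]
    refine ⟨?_, (hR R le_rfl ()).submatrix (Prod.snd : Fin 1 × Fin n → Fin n)⟩
    ext1 k l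
    exact isHermitian_witness i j μ R
  exact not_nonneg_dotProduct_witness_mulVec hij μ R
    (nonneg_of_mem_decomp_one hmem (star_planeVec i j μ))

theorem IsRealization.isFreeSpectrahedron {V : Type*} [AddCommGroup V] [Module ℂ V] [Star V]
    {C : ∀ s : ℕ, Set (Matrix (Fin s) (Fin s) V)} {u : V} {H : Type*} [NormedAddCommGroup H]
    [InnerProductSpace ℂ H] [CompleteSpace H] [FiniteDimensional ℂ H] {φ : V →ₗ[ℂ] (H →L[ℂ] H)}
    (hC : ∀ s, ∀ A ∈ C s, A.IsHermitian) (hφ : IsRealization C u φ) : IsFreeSpectrahedron C := by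
  let b := stdOrthonormalBasis ℂ H
  let ψ : V →ₗ[ℂ] Matrix (Fin (Module.finrank ℂ H)) (Fin (Module.finrank ℂ H)) ℂ :=
    { toFun := fun v => Matrix.of fun p q => inner ℂ (b p) (φ v (b q))
      map_add' := fun v w => by ext p q; simp
      map_smul' := fun c v => by ext p q; simp }
  have hψ : ∀ v, ψ (star v) = (ψ v)ᴴ := fun v => by
    ext p q
    change inner ℂ (b p) (φ (star v) (b q)) = star (inner ℂ (b q) (φ v (b p)))
    rw [hφ.map_star, ContinuousLinearMap.star_eq_adjoint, ContinuousLinearMap.adjoint_inner_right]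
    exact (inner_conj_symm _ _).symm
  refine ⟨_, ψ, hψ, fun s A => ?_⟩
  suffices h : A.IsHermitian → ((blockOperator (A.map φ)).IsPositive ↔
      (Matrix.comp _ _ _ _ ℂ (A.map ψ)).PosSemidef) from
    ⟨fun hA => ⟨hC s A hA, (h (hC s A hA)).1 ((hφ.mem_iff s A (hC s A hA)).1 hA)⟩,
      fun hA => (hφ.mem_iff s A hA.1).2 ((h hA.1).2 hA.2)⟩
  intro hA
  have hherm : (Matrix.comp _ _ _ _ ℂ (A.map ψ)).IsHermitian := by
    ext ⟨k, p⟩ ⟨l, q⟩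
    have h1 : ψ (star (A l k)) p q = star (ψ (A l k) q p) := by rw [hψ]; rfl
    change star (ψ (A l k) q p) = ψ (A k l) p q
    rw [← h1, show star (A l k) = A k l from congrFun (congrFun hA k) l]
  have key : ∀ z : Fin s × Fin (Module.finrank ℂ H) → ℂ,
      inner ℂ (WithLp.toLp 2 fun k => ∑ p, z (k, p) • b p)
        (blockOperator (A.map φ) (WithLp.toLp 2 fun k => ∑ p, z (k, p) • b p)) =
      star z ⬝ᵥ (Matrix.comp _ _ _ _ ℂ (A.map ψ)) *ᵥ z := fun z => by
    rw [PiLp.inner_apply]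
    simp only [blockOperator_apply, map_sum, map_smul, inner_sum, sum_inner, inner_smul_left,
      inner_smul_right, dotProduct, Matrix.mulVec, Fintype.sum_prod_type, Finset.mul_sum]
    refine Finset.sum_congr rfl fun k _ => ?_
    rw [Finset.sum_comm (s := (Finset.univ : Finset (Fin (Module.finrank ℂ H))))]
    refine Finset.sum_congr rfl fun l _ => ?_
    rw [Finset.sum_comm]
    refine Finset.sum_congr rfl fun p _ => Finset.sum_congr rfl fun q _ => ?_
    change _ = star (z (k, p)) * (inner ℂ (b p) (φ (A k l) (b q)) * z (l, q))
    rw [Matrix.map_apply, Complex.star_def]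
    ring
  have hsurj : ∀ x : PiLp 2 (fun _ : Fin s => H), ∃ z : Fin s × Fin (Module.finrank ℂ H) → ℂ,
      x = WithLp.toLp 2 fun k => ∑ p, z (k, p) • b p := fun x => by
    refine ⟨fun a => b.repr (x a.1) a.2, ?_⟩
    ext k
    exact (b.sum_repr (x k)).symm
  rw [Matrix.posSemidef_iff_dotProduct_mulVec]
  constructor
  · intro h
    refine ⟨hherm, fun z => ?_⟩
    rw [← key]
    exact h.inner_nonneg_right _
  · rintro ⟨-, h⟩
    rw [ContinuousLinearMap.isPositive_iff_complex]
    intro x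
    obtain ⟨z, rfl⟩ := hsurj x
    have := h z
    rw [← key, ← inner_conj_symm, Complex.nonneg_iff, Complex.conj_re, Complex.conj_im,
      zero_eq_neg] at this
    exact ⟨Complex.ext rfl this.2.symm, this.1⟩

end OpSys

theorem theorem3p1 (d : ℕ) (hd : 2 ≤ d) :
    (OpSys.IsOperatorSystem (OpSys.decomp d) (1 : Matrix (Fin d) (Fin d) ℂ) ∧
      ¬ OpSys.FiniteDimRealizable.{w} (OpSys.decomp d) (1 : Matrix (Fin d) (Fin d) ℂ) ∧
      ¬ OpSys.IsFreeSpectrahedron (OpSys.decomp d)) ∧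
    (OpSys.IsOperatorSystem (OpSys.dpsd d) (1 : Matrix (Fin d) (Fin d) ℂ) ∧
      ¬ OpSys.FinitelyGenerated (OpSys.dpsd d)) ∧
    ¬ OpSys.HasFinitaryChoiCharacterization d := by
  refine ⟨⟨OpSys.isOperatorSystem_decomp, ?_, OpSys.not_isFreeSpectrahedron_decomp hd⟩,
    ⟨OpSys.isOperatorSystem_dpsd, OpSys.not_finitelyGenerated_dpsd hd⟩,
    OpSys.not_hasFinitaryChoiCharacterization hd⟩
  rintro ⟨H, _, _, _, _, φ, hφ⟩
  exact OpSys.not_isFreeSpectrahedron_decomp hd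
    (hφ.isFreeSpectrahedron OpSys.isOperatorSystem_decomp.isHermitian)
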